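/- **Notation.** For $m\ge 0$ let $\Lambda(\mathbb F_m)$ be the space of rooted Schreier graphs of the free group $\mathbb F_m$ on $m$ free generators $x_1,\dots,x_m$: the Schreier graph of a subgroup $H\le\mathbb F_m$ has the cosets $Hg$ as vertices, the root $H$, and an edge labeled $i$ directed from $Hg$ to $Hgx_i$. Let $\Omega_m$ be the space of isomorphism classes of connected rooted $2m$-regular multigraphs (loops, which count twice, and multiple edges are allowed). Both carry the Borel $\sigma$-algebra of the topology given by the $r$-neighborhoods of the root. Let $f:\Lambda(\mathbb F_m)\to\Omega_m$ forget the labels and orientations of the edges. A probability measure $\mu$ on $\Lambda(\mathbb F_m)$ is *invariant* if for the equivalence relation $\mathcal E$ "isomorphic as unrooted labeled graphs" the left and right counting measures coincide, i.e. $\int|\{K:(H,K)\in A\}|\,d\mu(H)=\int|\{H:(H,K)\in A\}|\,d\mu(K)$ for every Borel set $A\subseteq\mathcal E$; it is *nonatomic* if every point has measure $0$. For a finite generating family $s_1,\dots,s_m$ of a group $G$, the unlabeled Cayley graph $\mathrm{Cay}(G;s_1,\dots,s_m)\in\Omega_m$ has vertex set $G$, root $1$, and one edge between $g$ and $gs_i$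 for all $g\in G$ and $1\le i\le m$. Say that $\mu$ is a *nonatomic invariant lift* of $\delta_\Gamma$, where $\Gamma\in\Omega_m$, if $\mu$ is a nonatomic invariant probability measure on $\Lambda(\mathbb F_m)$ with $f_*\mu=\delta_\Gamma$. **Theorem.** Let $G$ be an infinite noncyclic group generated by $a_1,\dots,a_n$, and suppose that no product $a_ia_j$ with $i\ne j$ has order two. Then: 1. The Dirac measure concentrated on an unlabeled Cayley graph of $G$ has a nonatomic invariant lift. More precisely, there are $k\ge 0$ and $b_1,\dots,b_k\in G$ such that $\delta_{\mathrm{Cay}(G;a_1,\dots,a_n,b_1,\dots,b_k)}$ has a nonatomic invariant lift $\mu$ on $\Lambda(\mathbb F_{n+k})$. 2. Let $i\neq j$ be such that $a_{n+1}:=a_ia_j$ is not the identity and there are infinitely many $a_{n+1}$-cycles, i.e. cosets $g\langle a_{n+1}\rangle$ in $G$. Then for every $p\in(0,1)$, the law $\mu_p$ of the random Schreier graph obtained from the labeled Cayley graph of $G$ with respect to $a_1,\dots,a_n,a_{n+1}$ by reversing the orientation of each $a_{n+1}$-cycle independently with probability $p$ is a nonatomic invariant lift of $\delta_{\mathrm{Cay}(G;a_1,\dots,a_n,a_{n+1})}$.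 3. If no cyclic subgroup of $G$ has finite index, then there are $i\ne j$ as in 2. -/

import Mathlib

open MeasureTheory
open scoped ENNReal

universe u

/-! ## Rooted graphs -/

/-- A rooted multigraph (loops and multiple edges are allowed). -/
structure RootedGraph : Type (u + 1) where
  /-- the ambient type of vertices -/
  V : Type u
  /-- the ambient type of edges -/
  E : Type u
  /-- the underlying undirected multigraph -/
  graph : Graph V E
  /-- the root -/
  root : V
  root_mem : root ∈ graph.vertexSet

namespace RootedGraph

/-- Two rooted graphs are isomorphic: there are bijections of the vertices and of the edges
that preserve the incidence relation and the root. -/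
def Iso (Γ Δ : RootedGraph.{u}) : Prop :=
  ∃ (φ : Γ.graph.vertexSet ≃ Δ.graph.vertexSet) (ψ : Γ.graph.edgeSet ≃ Δ.graph.edgeSet),
    φ ⟨Γ.root, Γ.root_mem⟩ = ⟨Δ.root, Δ.root_mem⟩ ∧
    ∀ (e : Γ.graph.edgeSet) (x y : Γ.graph.vertexSet),
      Γ.graph.IsLink e x y ↔ Δ.graph.IsLink (ψ e) (φ x) (φ y)

theorem Iso.refl (Γ : RootedGraph.{u}) : Γ.Iso Γ :=
  ⟨Equiv.refl _, Equiv.refl _, rfl, fun _ _ _ => Iff.rfl⟩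

theorem Iso.symm {Γ Δ : RootedGraph.{u}} (h : Γ.Iso Δ) : Δ.Iso Γ := by
  obtain ⟨φ, ψ, h₁, h₂⟩ := h
  refine ⟨φ.symm, ψ.symm, by rw [← h₁, Equiv.symm_apply_apply], fun e x y => ?_⟩
  rw [h₂ (ψ.symm e) (φ.symm x) (φ.symm y)]
  simp only [Equiv.apply_symm_apply]

theorem Iso.trans {Γ Δ Θ : RootedGraph.{u}} (h : Γ.Iso Δ) (k : Δ.Iso Θ) : Γ.Iso Θ := by
  obtain ⟨φ, ψ, h₁, h₂⟩ := h
  obtain ⟨φ', ψ', k₁, k₂⟩ := k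
  refine ⟨φ.trans φ', ψ.trans ψ', by simp [h₁, k₁], fun e x y => ?_⟩
  rw [h₂, k₂]
  rfl

/-- The set of vertices at distance at most `r` from the root. -/
def ball (Γ : RootedGraph.{u}) : ℕ → Set Γ.V
  | 0 => {Γ.root}
  | r + 1 => ball Γ r ∪ {y | ∃ x ∈ ball Γ r, Γ.graph.Adj x y}

theorem root_mem_ball (Γ : RootedGraph.{u}) (r : ℕ) : Γ.root ∈ Γ.ball r := by
  induction r with
  | zero => exact Set.mem_singleton _
  | succ r ih => exact Or.inl ih

/-- The `r`-neighbourhood of the root, as a rooted graph: the subgraph induced by the vertices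
at distance at most `r` from the root. -/
def nbhd (Γ : RootedGraph.{u}) (r : ℕ) : RootedGraph.{u} where
  V := Γ.V
  E := Γ.E
  graph := Γ.graph.induce (Γ.ball r)
  root := Γ.root
  root_mem := Γ.root_mem_ball r

/-- Every vertex is at finite distance from the root. -/
def Connected (Γ : RootedGraph.{u}) : Prop :=
  ∀ v ∈ Γ.graph.vertexSet, ∃ r, v ∈ Γ.ball r

/-- The degree of a vertex; a loop contributes two. -/
noncomputable def degree (Γ : RootedGraph.{u}) (v : Γ.V) : ℕ∞ :=
  {e | Γ.graph.IsNonloopAt e v}.encard + 2 * {e | Γ.graph.IsLoopAt e v}.encard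

/-- Every vertex has degree `d`. -/
def Regular (Γ : RootedGraph.{u}) (d : ℕ) : Prop :=
  ∀ v ∈ Γ.graph.vertexSet, Γ.degree v = d

end RootedGraph

/-- Isomorphism, as an equivalence relation on connected rooted `2m`-regular graphs. -/
instance rootedGraphSetoid (m : ℕ) :
    Setoid {Γ : RootedGraph.{u} // Γ.Connected ∧ Γ.Regular (2 * m)} where
  r Γ Δ := Γ.1.Iso Δ.1
  iseqv := ⟨fun Γ => .refl Γ.1, fun h => h.symm, fun h k => h.trans k⟩

/-- The space `Ω` of isomorphism classes of connected rooted `2m`-regular graphs. -/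
def GraphSpace (m : ℕ) : Type (u + 1) :=
  Quotient (rootedGraphSetoid.{u} m)

/-- The cylinder set of all rooted graphs whose `r`-neighbourhood of the root is isomorphic to the
one of `Γ`. -/
def graphCylinder (m : ℕ) (Γ : RootedGraph.{u}) (r : ℕ) : Set (GraphSpace.{u} m) :=
  {ω | ∃ Δ : {Δ : RootedGraph.{u} // Δ.Connected ∧ Δ.Regular (2 * m)},
    Quotient.mk _ Δ = ω ∧ (Δ.1.nbhd r).Iso (Γ.nbhd r)}

/-- The Borel σ-algebra of `Ω`. For each `r` there are only finitely many cylinder sets, and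
the cylinder sets are a basis of the topology, so they generate the Borel sets. -/
instance (m : ℕ) : MeasurableSpace (GraphSpace.{u} m) :=
  MeasurableSpace.generateFrom
    {A | ∃ Γ : RootedGraph.{u}, Γ.Connected ∧ Γ.Regular (2 * m) ∧
      ∃ r : ℕ, A = graphCylinder m Γ r}

/-! ## Schreier structures and their underlying graphs

A Schreier structure with `m` labels on a vertex set `V` has, at each vertex and for each label
`i`, exactly one outgoing and one incoming edge labelled `i`. It is thus the same thing as a
family of `m` permutations of `V`: the edges are the pairs `(x, i)`, and `(x, i)` is directed from
`x` to `σ i x` and labelled `i`. -/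

/-- The underlying unlabelled and undirected multigraph of a Schreier structure. -/
def underlyingGraph {V : Type u} {m : ℕ} (σ : Fin m → Equiv.Perm V) : Graph V (V × Fin m) where
  vertexSet := Set.univ
  IsLink e x y := (x = e.1 ∧ y = σ e.2 e.1) ∨ (y = e.1 ∧ x = σ e.2 e.1)
  isLink_symm := fun _ _ => ⟨fun _ _ h => h.symm⟩
  eq_or_eq_of_isLink_of_isLink := by
    rintro e x y v w (⟨rfl, rfl⟩ | ⟨rfl, rfl⟩) (⟨rfl, rfl⟩ | ⟨rfl, rfl⟩) <;> simp
  left_mem_of_isLink := fun _ _ _ _ => Set.mem_univ _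

/-- The underlying rooted graph of a rooted Schreier structure. -/
def underlyingRooted {V : Type u} {m : ℕ} (σ : Fin m → Equiv.Perm V) (o : V) :
    RootedGraph.{u} where
  V := V
  E := V × Fin m
  graph := underlyingGraph σ
  root := o
  root_mem := Set.mem_univ _

theorem underlyingRooted_connected {V : Type u} {m : ℕ} (σ : Fin m → Equiv.Perm V) (o : V)
    (h : ∀ S : Set V, o ∈ S → (∀ i x, x ∈ S ↔ σ i x ∈ S) → ∀ v, v ∈ S) :
    (underlyingRooted σ o).Connected := by
  intro v _
  refine h {v | ∃ r, v ∈ (underlyingRooted σ o).ball r} ⟨0, rfl⟩ (fun i x => ⟨?_, ?_⟩) v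
  · rintro ⟨r, hr⟩
    exact ⟨r + 1, Or.inr ⟨x, hr, (x, i), Or.inl ⟨rfl, rfl⟩⟩⟩
  · rintro ⟨r, hr⟩
    exact ⟨r + 1, Or.inr ⟨σ i x, hr, (x, i), Or.inr ⟨rfl, rfl⟩⟩⟩

theorem underlyingRooted_regular {V : Type u} {m : ℕ} (σ : Fin m → Equiv.Perm V) (o : V) :
    (underlyingRooted σ o).Regular (2 * m) := by
  suffices H : ∀ v : V, {e | (underlyingGraph σ).IsNonloopAt e v}.encard
      + 2 * {e | (underlyingGraph σ).IsLoopAt e v}.encard = ((2 * m : ℕ) : ℕ∞) from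
    fun v _ => H v
  intro v
  have hN : {e | (underlyingGraph σ).IsNonloopAt e v} =
      ((fun i => (v, i)) '' {i | σ i v ≠ v}) ∪
        ((fun i => ((σ i).symm v, i)) '' {i | σ i v ≠ v}) := by
    ext ⟨x, i⟩
    constructor
    · rintro ⟨y, hy, (⟨h₁, h₂⟩ | ⟨h₁, h₂⟩)⟩
      · dsimp only at h₁ h₂
        subst h₁ h₂
        exact Or.inl ⟨i, hy, rfl⟩
      · dsimp only at h₁ h₂
        subst h₁ h₂
        exact Or.inr ⟨i, fun h => hy ((σ i).injective h).symm,
          Prod.ext ((σ i).symm_apply_apply y) rfl⟩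
    · rintro (⟨j, hj, h⟩ | ⟨j, hj, h⟩)
      · obtain ⟨rfl, rfl⟩ := Prod.mk.inj h
        exact ⟨σ j v, hj, Or.inl ⟨rfl, rfl⟩⟩
      · obtain ⟨rfl, rfl⟩ := Prod.mk.inj h
        exact ⟨(σ j).symm v, fun h => hj (((σ j).symm_apply_eq).1 h).symm,
          Or.inr ⟨rfl, ((σ j).apply_symm_apply v).symm⟩⟩
  have hL : {e | (underlyingGraph σ).IsLoopAt e v} = (fun i => (v, i)) '' {i | σ i v = v} := by
    ext ⟨x, i⟩
    constructor
    · rintro (⟨h₁, h₂⟩ | ⟨h₁, h₂⟩) <;>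
      · dsimp only at h₁ h₂
        subst h₁
        exact ⟨i, h₂.symm, rfl⟩
    · rintro ⟨j, hj, h⟩
      obtain ⟨rfl, rfl⟩ := Prod.mk.inj h
      exact Or.inl ⟨rfl, hj.symm⟩
  have hd : Disjoint ((fun i => (v, i)) '' {i | σ i v ≠ v})
      ((fun i => ((σ i).symm v, i)) '' {i | σ i v ≠ v}) := by
    rw [Set.disjoint_left]
    rintro _ ⟨i, hi, rfl⟩ ⟨j, hj, h⟩
    have h' : (σ j).symm v = v ∧ j = i := Prod.mk.inj h
    exact hj (((σ j).symm_apply_eq).1 h'.1).symm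
  have hs : {i | σ i v ≠ v}.encard + {i | σ i v = v}.encard = (m : ℕ∞) := by
    have := Set.encard_add_encard_compl {i | σ i v ≠ v}
    have h2 : {i | σ i v ≠ v}ᶜ = {i | σ i v = v} := by ext; simp
    rw [h2] at this
    rw [this]
    simp
  have hi : ∀ (g : Fin m → V) (s : Set (Fin m)), ((fun i => (g i, i)) '' s).encard = s.encard :=
    fun g s => Function.Injective.encard_image (fun _ _ h => congrArg Prod.snd h) s
  rw [hN, hL, Set.encard_union_eq hd, hi (fun _ => v), hi (fun i => (σ i).symm v),
    hi (fun _ => v), ← two_mul, ← mul_add, hs]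
  push_cast
  rfl

/-! ## The space of Schreier graphs -/

/-- The space `Λ` of (rooted) Schreier graphs of the free group of rank `m`. A Schreier graph is
given by a subgroup `H`: its vertices are the cosets `Hg`, its root is `H`, and an edge labelled
`i` is directed from `Hg` to `Hgaᵢ`. Distinct subgroups have nonisomorphic rooted labelled
graphs, and `H` is the set of words read along the closed paths at the root. -/
abbrev SchreierSpace (m : ℕ) : Type :=
  Subgroup (FreeGroup (Fin m))

/-- The Borel σ-algebra of `Λ`: it is generated by the sets of all Schreier graphs in
which a given word labels a closed path at the root. -/
instance (m : ℕ) : MeasurableSpace (SchreierSpace m) :=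
  MeasurableSpace.generateFrom
    {A | ∃ w : FreeGroup (Fin m), A = {H : SchreierSpace m | w ∈ H}}

/-- The vertices of the Schreier graph of `H`: the right cosets `Hg`. -/
abbrev Cosets {m : ℕ} (H : SchreierSpace m) : Type :=
  Quotient (QuotientGroup.rightRel H)

/-- The coset `Hg`. -/
def Cosets.mk {m : ℕ} (H : SchreierSpace m) (g : FreeGroup (Fin m)) : Cosets H :=
  Quotient.mk _ g

/-- The map `Hg ↦ Hgw` on right cosets. -/
def Cosets.mulRight {m : ℕ} {H : SchreierSpace m} (w : FreeGroup (Fin m)) :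
    Cosets H → Cosets H :=
  Quotient.map (fun g => g * w) fun g g' h => by
    change QuotientGroup.rightRel _ _ _ at h
    change QuotientGroup.rightRel _ _ _
    rw [QuotientGroup.rightRel_apply] at h ⊢
    simpa [mul_assoc] using h

/-- The Schreier structure on the cosets: the edge labelled `i` from `Hg` leads to `Hgaᵢ`. -/
def cosetStep {m : ℕ} (H : SchreierSpace m) (i : Fin m) : Equiv.Perm (Cosets H) where
  toFun := Cosets.mulRight (FreeGroup.of i)
  invFun := Cosets.mulRight (FreeGroup.of i)⁻¹
  left_inv := by
    rintro ⟨g⟩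
    exact congrArg (Cosets.mk H) (mul_inv_cancel_right g _)
  right_inv := by
    rintro ⟨g⟩
    exact congrArg (Cosets.mk H) (inv_mul_cancel_right g _)

/-- The same Schreier structure with the vertex set lifted to an arbitrary universe. -/
def schreierStep {m : ℕ} (H : SchreierSpace m) (i : Fin m) :
    Equiv.Perm (ULift.{u} (Cosets H)) :=
  Equiv.ulift.symm.permCongr (cosetStep H i)

theorem schreierStep_transitive {m : ℕ} (H : SchreierSpace m) (S : Set (ULift.{u} (Cosets H)))
    (h₁ : ULift.up (Cosets.mk H 1) ∈ S) (h₂ : ∀ i x, x ∈ S ↔ schreierStep H i x ∈ S)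
    (v : ULift.{u} (Cosets H)) : v ∈ S := by
  obtain ⟨⟨w⟩⟩ := v
  have key : ∀ w g : FreeGroup (Fin m),
      ULift.up (Cosets.mk H g) ∈ S ↔ ULift.up (Cosets.mk H (g * w)) ∈ S := by
    intro w
    induction w using FreeGroup.induction_on with
    | C1 => intro g; rw [mul_one]
    | of i => intro g; exact h₂ i _
    | inv_of i _ =>
      intro g
      have := h₂ i (ULift.up (Cosets.mk H (g * (FreeGroup.of i)⁻¹)))
      have e : schreierStep H i (ULift.up (Cosets.mk H (g * (FreeGroup.of i)⁻¹)))
          = ULift.up (Cosets.mk H g) :=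
        congrArg (fun g => ULift.up (Cosets.mk H g)) (inv_mul_cancel_right g _)
      rw [e] at this
      exact this.symm
    | mul x y hx hy => intro g; rw [hx g, hy (g * x), mul_assoc]
  have := (key w 1).1 h₁
  rwa [one_mul] at this

/-- The forgetful map `f : Λ → Ω` that sends a Schreier graph to its underlying unlabelled
and undirected rooted graph. -/
def forget {m : ℕ} (H : SchreierSpace m) : GraphSpace.{u} m :=
  Quotient.mk _ ⟨underlyingRooted (schreierStep.{u} H) (ULift.up (Cosets.mk H 1)),
    underlyingRooted_connected _ _ (schreierStep_transitive H), underlyingRooted_regular _ _⟩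

/-! ## Invariant measures -/

/-- The equivalence relation on `Λ`: the two Schreier graphs are isomorphic as unrooted
labelled graphs. -/
def UnrootedIso {m : ℕ} (H K : SchreierSpace m) : Prop :=
  ∃ φ : Cosets H ≃ Cosets K, ∀ i x, φ (cosetStep H i x) = cosetStep K i (φ x)

/-- The left counting measure, on the equivalence relation above, of the trace of `A`. -/
noncomputable def leftCounting {m : ℕ} (μ : Measure (SchreierSpace m))
    (A : Set (SchreierSpace m × SchreierSpace m)) : ℝ≥0∞ :=
  ∫⁻ H, ({K | UnrootedIso H K ∧ (H, K) ∈ A}.encard : ℝ≥0∞) ∂μ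

/-- The right counting measure, on the equivalence relation above, of the trace of `A`. -/
noncomputable def rightCounting {m : ℕ} (μ : Measure (SchreierSpace m))
    (A : Set (SchreierSpace m × SchreierSpace m)) : ℝ≥0∞ :=
  ∫⁻ K, ({H | UnrootedIso H K ∧ (H, K) ∈ A}.encard : ℝ≥0∞) ∂μ

/-- A measure on `Λ` is invariant if the left and right counting measures on the equivalence
relation coincide. -/
def IsInvariantMeasure {m : ℕ} (μ : Measure (SchreierSpace m)) : Prop :=
  ∀ A : Set (SchreierSpace m × SchreierSpace m), MeasurableSet A →
    leftCounting μ A = rightCounting μ A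

/-! ## Cayley graphs -/

theorem cayley_transitive {G : Type u} [Group G] {m : ℕ} (s : Fin m → G)
    (hs : Subgroup.closure (Set.range s) = ⊤) (S : Set G) (h₁ : (1 : G) ∈ S)
    (h₂ : ∀ i x, x ∈ S ↔ Equiv.mulRight (s i) x ∈ S) (v : G) : v ∈ S := by
  have key : ∀ w ∈ Subgroup.closure (Set.range s), ∀ g : G, g ∈ S ↔ g * w ∈ S := by
    intro w hw
    induction hw using Subgroup.closure_induction with
    | mem x hx => obtain ⟨i, rfl⟩ := hx; exact h₂ i
    | one => intro g; rw [mul_one]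
    | mul x y _ _ hx hy => intro g; rw [hx g, hy (g * x), mul_assoc]
    | inv x _ hx => intro g; rw [hx (g * x⁻¹), inv_mul_cancel_right]
  have := (key v (hs ▸ Subgroup.mem_top v) 1).1 h₁
  rwa [one_mul] at this

/-- The point of `Ω` given by the unlabelled Cayley graph of `G` with respect to the finite
generating family `s`, rooted at the identity: there is one edge between `g` and `g * s i` for
every `g` and every `i`. -/
def cayleyGraph {G : Type u} [Group G] {m : ℕ} (s : Fin m → G)
    (hs : Subgroup.closure (Set.range s) = ⊤) : GraphSpace.{u} m :=
  Quotient.mk _ ⟨underlyingRooted (fun i => Equiv.mulRight (s i)) (1 : G),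
    underlyingRooted_connected _ _ (cayley_transitive s hs), underlyingRooted_regular _ _⟩

/-- A generating family still generates after adjoining further elements. -/
theorem closure_append {G : Type u} [Group G] {n k : ℕ} {a : Fin n → G}
    (ha : Subgroup.closure (Set.range a) = ⊤) (b : Fin k → G) :
    Subgroup.closure (Set.range (Fin.append a b)) = ⊤ := by
  rw [eq_top_iff, ← ha]
  refine Subgroup.closure_mono ?_
  rintro _ ⟨i, rfl⟩
  exact ⟨Fin.castAdd k i, Fin.append_left a b i⟩

/-! ## Random reversal of cycles -/

/-- The Schreier graph (as a subgroup) of a rooted Schreier structure: the set of all words read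
along closed paths at the root `o`. Paths are read from left to right, whence the opposite
group. -/
def fundamentalGroup {V : Type u} {m : ℕ} (σ : Fin m → Equiv.Perm V) (o : V) :
    SchreierSpace m :=
  (MulAction.stabilizer (Equiv.Perm V) o).op.comap
    (FreeGroup.lift fun i => MulOpposite.op (σ i))

/-- The permutation `x ↦ x * c` of `G`, reversed to `x ↦ x * c⁻¹` on the `c`-cycles
`x⟨c⟩` at which `ω` is `true`. -/
noncomputable def reversal {G : Type u} [Group G] (c : G)
    (ω : G ⧸ Subgroup.zpowers c → Bool) : Equiv.Perm G where
  toFun x := if ω x = true then x * c⁻¹ else x * c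
  invFun x := if ω x = true then x * c else x * c⁻¹
  left_inv x := by
    have h₁ : ((x * c : G) : G ⧸ Subgroup.zpowers c) = x :=
      QuotientGroup.mk_mul_of_mem x (Subgroup.mem_zpowers c)
    have h₂ : ((x * c⁻¹ : G) : G ⧸ Subgroup.zpowers c) = x :=
      QuotientGroup.mk_mul_of_mem x (inv_mem (Subgroup.mem_zpowers c))
    by_cases h : ω x = true <;> simp [h, h₁, h₂]
  right_inv x := by
    have h₁ : ((x * c : G) : G ⧸ Subgroup.zpowers c) = x :=
      QuotientGroup.mk_mul_of_mem x (Subgroup.mem_zpowers c)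
    have h₂ : ((x * c⁻¹ : G) : G ⧸ Subgroup.zpowers c) = x :=
      QuotientGroup.mk_mul_of_mem x (inv_mem (Subgroup.mem_zpowers c))
    by_cases h : ω x = true <;> simp [h, h₁, h₂]

/-- The Schreier graph obtained from the labelled Cayley graph of `G` with respect to
`a₁, …, aₙ, c` by reversing the orientations of those `c`-cycles at which `ω` is `true`. -/
noncomputable def reversedSchreier {G : Type u} [Group G] {n : ℕ} (a : Fin n → G) (c : G)
    (ω : G ⧸ Subgroup.zpowers c → Bool) : SchreierSpace (n + 1) :=
  fundamentalGroup (Fin.append (fun i => Equiv.mulRight (a i)) ![reversal c ω]) (1 : G)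

/-- The law of the random Schreier graph obtained from the labelled Cayley graph of `G` with
respect to `a₁, …, aₙ, c` by reversing the orientation of each `c`-cycle independently with
probability `p`. -/
noncomputable def reversalMeasure {G : Type u} [Group G] {n : ℕ} (a : Fin n → G) (c : G)
    (p : unitInterval) : Measure (SchreierSpace (n + 1)) :=
  (Measure.infinitePi fun _ : G ⧸ Subgroup.zpowers c =>
    ProbabilityTheory.bernoulliMeasure true false p).map (reversedSchreier a c)

/-- `μ` is a nonatomic invariant probability measure on `Λ` whose image under the forgetful map
is the Dirac measure at `Γ`. -/
structure IsNonatomicInvariantLift {m : ℕ} (μ : Measure (SchreierSpace m))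
    (Γ : GraphSpace.{u} m) : Prop where
  isProbabilityMeasure : IsProbabilityMeasure μ
  nonatomic : ∀ H : SchreierSpace m, μ {H} = 0
  isInvariant : IsInvariantMeasure μ
  map_forget : μ.map forget.{u} = Measure.dirac Γ

/-!
All lifts come from one construction. Let `H` be a subgroup of `G` of infinite index and let `ω` be
an independent Bernoulli configuration on `G ⧸ H`. Let the edge labelled `i` lead from `x` to
`x * u i (ω (xH)) * t i`, where `u i` takes values in `H` (`twistedStep`). Each label permutes `G`,
since right multiplication by `u i (ω (xH))` is a permutation of every coset `xH`.

* Rerooting at a neighbour of the identity translates `ω` by `u i (ω H) * t i`. The factor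
  `u i (ω H)` fixes the coset `H`, whose value determines it, so conditioning on that value shows
  that this random translation preserves the law of `ω` (`measurePreserving_shift_of_base`). Hence
  the law of the Schreier graph is invariant under conjugation, and conjugation-invariance
  gives equality of the two counting measures (`isInvariantMeasure_of_conjBy`).
* If some labels carry a fixed generating family of `G`, all vertices are reached by deterministic
  words, so that `ω` can be recovered from the Schreier graph (`twistedSchreier_injective`). As
  `G ⧸ H` is infinite, the law of `ω`, and with it the law of the Schreier graph, has no atoms.
* If for every `ω` the unlabelled graph is a given Cayley graph, the forgetful map is constant on
  the set of twisted Schreier graphs. This set is compact, hence measurable, and has full measure;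
  so the measurability of the forgetful map itself never enters.

Reversal of `c`-cycles is the case `H = ⟨c⟩` and `u = c` or `c⁻¹`; the orientations are visible
because `c² ≠ 1`. For the existence of a lift without any assumption on cyclic subgroups, two
generators `t` and `z * t` are adjoined, where `z ≠ 1` generates a subgroup of infinite index, and
their labels are exchanged at random on the cosets of `⟨z⟩`. Such a `z` exists because otherwise `G`
would be torsion-free with all nontrivial cyclic subgroups of finite index, and the transfer into
the centre would show that `G` is cyclic (`isCyclic_of_finiteIndex_zpowers`).
-/

/-! ### Cyclic subgroups of infinite index -/

/-- A torsion-free finitely generated group all of whose nontrivial cyclic subgroups have finite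
index is cyclic: an intersection of centralizers shows that the centre has finite index, so the
transfer into the centre embeds the group into its centre, and a further power map embeds it into a
cyclic subgroup. -/
theorem isCyclic_of_finiteIndex_zpowers {G : Type u} [Group G] {n : ℕ} {a : Fin n → G}
    (ha : Subgroup.closure (Set.range a) = ⊤)
    (htf : ∀ (g : G) (k : ℕ), k ≠ 0 → g ^ k = 1 → g = 1)
    (hfin : ∀ g : G, g ≠ 1 → (Subgroup.zpowers g).FiniteIndex) : IsCyclic G := by
  by_cases htriv : ∀ g : G, g = 1
  · exact ⟨1, fun g => ⟨0, by simp [htriv g]⟩⟩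
  push Not at htriv
  obtain ⟨z, hz⟩ := htriv
  have hcent : (Subgroup.center G).FiniteIndex := by
    rw [Subgroup.center_eq_iInf ha, ← iInf_subtype'']
    refine Subgroup.finiteIndex_iInf fun g => ?_
    by_cases hg : (g : G) = 1
    · have : Subgroup.centralizer {(g : G)} = ⊤ := by
        rw [hg, eq_top_iff]
        intro x _
        simp [Subgroup.mem_centralizer_iff]
      rw [this]
      infer_instance
    · have := hfin g hg
      refine Subgroup.finiteIndex_of_le (H := Subgroup.zpowers (g : G)) ?_
      rw [Subgroup.zpowers_le]
      simp [Subgroup.mem_centralizer_iff]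
  have hcomm : ∀ x y : G, x * y = y * x := by
    intro x y
    have hinj : Function.Injective (MonoidHom.transferCenterPow G) := by
      rw [injective_iff_map_eq_one]
      intro g hg
      refine htf g _ hcent.index_ne_zero ?_
      rw [← MonoidHom.transferCenterPow_apply, hg, Subgroup.coe_one]
    refine hinj ?_
    rw [map_mul, map_mul]
    exact Subtype.ext (Subgroup.mem_center_iff.1 (MonoidHom.transferCenterPow G y).2 _)
  let _ : CommGroup G := { ‹Group G› with mul_comm := hcomm }
  have hzi := hfin z hz
  let f : G →* Subgroup.zpowers z :=
    (powMonoidHom (Subgroup.zpowers z).index).codRestrict _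
      fun g => Subgroup.pow_index_mem (Subgroup.zpowers z) g
  refine isCyclic_of_injective f ?_
  rw [injective_iff_map_eq_one]
  exact fun g hg => htf g _ hzi.index_ne_zero (congrArg Subtype.val hg)

/-- In an infinite noncyclic finitely generated group some nontrivial cyclic subgroup has infinite
index. -/
theorem exists_infinite_quotient_zpowers {G : Type u} [Group G] [Infinite G] (hG : ¬ IsCyclic G)
    {n : ℕ} {a : Fin n → G} (ha : Subgroup.closure (Set.range a) = ⊤) :
    ∃ z : G, z ≠ 1 ∧ Infinite (G ⧸ Subgroup.zpowers z) := by
  by_contra! h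
  have hfin : ∀ g : G, g ≠ 1 → (Subgroup.zpowers g).FiniteIndex := fun g hg =>
    Subgroup.finiteIndex_iff_finite_quotient.2 (h g hg)
  refine hG (isCyclic_of_finiteIndex_zpowers ha (fun g k hk hgk => ?_) hfin)
  by_contra hg
  have h₁ := h g hg
  -- A finite subgroup of finite index forces the group to be finite.
  have h₂ : Finite (Subgroup.zpowers g) :=
    finite_zpowers.2 (isOfFinOrder_iff_pow_eq_one.2 ⟨k, Nat.pos_of_ne_zero hk, hgk⟩)
  have : Finite G :=
    Finite.of_equiv _ (Subgroup.groupEquivQuotientProdSubgroup (s := Subgroup.zpowers g)).symm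
  exact not_finite G

/-- If all products of two distinct generators are trivial, the group is cyclic, because every
generator is then the inverse of every other one. -/
theorem isCyclic_of_mul_eq_one {G : Type u} [Group G] {n : ℕ} {a : Fin n → G}
    (ha : Subgroup.closure (Set.range a) = ⊤) (h : ∀ i j, i ≠ j → a i * a j = 1) :
    IsCyclic G := by
  rcases n with _ | n
  · refine ⟨1, fun g => ?_⟩
    have : g ∈ Subgroup.closure (Set.range a) := ha ▸ Subgroup.mem_top g
    rw [Set.range_eq_empty, Subgroup.closure_empty, Subgroup.mem_bot] at this
    exact this ▸ one_mem (Subgroup.zpowers (1 : G))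
  · refine ⟨a 0, fun g => ?_⟩
    have hle : Subgroup.closure (Set.range a) ≤ Subgroup.zpowers (a 0) := by
      rw [Subgroup.closure_le]
      rintro _ ⟨i, rfl⟩
      by_cases hi : i = 0
      · exact hi ▸ Subgroup.mem_zpowers _
      · rw [eq_inv_of_mul_eq_one_left (h i 0 hi)]
        exact inv_mem (Subgroup.mem_zpowers _)
    exact hle (ha ▸ Subgroup.mem_top g)

/-! ### Conjugation of Schreier graphs -/

/-- The conjugate `w⁻¹Hw`, that is, the Schreier graph `H` rerooted at the vertex `Hw`. -/
def conjBy {m : ℕ} (w : FreeGroup (Fin m)) (H : SchreierSpace m) : SchreierSpace m :=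
  H.comap (MulAut.conj w).toMonoidHom

theorem mem_conjBy {m : ℕ} {w x : FreeGroup (Fin m)} {H : SchreierSpace m} :
    x ∈ conjBy w H ↔ w * x * w⁻¹ ∈ H := Iff.rfl

theorem conjBy_one {m : ℕ} (H : SchreierSpace m) : conjBy 1 H = H := by
  ext x
  simp [mem_conjBy]

theorem conjBy_conjBy {m : ℕ} (v w : FreeGroup (Fin m)) (H : SchreierSpace m) :
    conjBy w (conjBy v H) = conjBy (v * w) H := by
  ext x
  simp [mem_conjBy, mul_assoc]

theorem conjBy_inv_eq_iff {m : ℕ} {w : FreeGroup (Fin m)} {H K : SchreierSpace m} :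
    conjBy w⁻¹ K = H ↔ conjBy w H = K := by
  constructor <;> rintro rfl <;> simp [conjBy_conjBy, conjBy_one]

theorem Cosets.mk_eq_mk {m : ℕ} {H : SchreierSpace m} {g g' : FreeGroup (Fin m)} :
    Cosets.mk H g = Cosets.mk H g' ↔ g' * g⁻¹ ∈ H := by
  rw [← QuotientGroup.rightRel_apply]
  exact Quotient.eq

theorem Cosets.mulRight_mulRight {m : ℕ} {H : SchreierSpace m} (v w : FreeGroup (Fin m))
    (x : Cosets H) : Cosets.mulRight w (Cosets.mulRight v x) = Cosets.mulRight (v * w) x := by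
  obtain ⟨g⟩ := x
  exact congrArg (Cosets.mk H) (mul_assoc g v w)

theorem Cosets.map_mulRight {m : ℕ} {H K : SchreierSpace m} (φ : Cosets H → Cosets K)
    (hφ : ∀ i x, φ (cosetStep H i x) = cosetStep K i (φ x)) (w : FreeGroup (Fin m)) :
    ∀ x, φ (Cosets.mulRight w x) = Cosets.mulRight w (φ x) := by
  have hone : ∀ (L : SchreierSpace m) (x : Cosets L), Cosets.mulRight 1 x = x := by
    rintro L ⟨g⟩
    exact congrArg (Cosets.mk L) (mul_one g)
  induction w using FreeGroup.induction_on with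
  | C1 => intro x; rw [hone, hone]
  | of i => exact hφ i
  | inv_of i _ =>
    intro x
    have := hφ i (Cosets.mulRight (FreeGroup.of i)⁻¹ x)
    change φ (Cosets.mulRight _ _) = Cosets.mulRight _ _ at this
    rw [Cosets.mulRight_mulRight, inv_mul_cancel, hone] at this
    rw [this, Cosets.mulRight_mulRight, mul_inv_cancel, hone]
  | mul x y hx hy =>
    intro z
    rw [← Cosets.mulRight_mulRight, hy, hx, Cosets.mulRight_mulRight]

/-- Schreier graphs are isomorphic as unrooted labelled graphs if and only if the subgroups are
conjugate. -/
theorem unrootedIso_iff {m : ℕ} {H K : SchreierSpace m} :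
    UnrootedIso H K ↔ ∃ w, conjBy w H = K := by
  constructor
  · rintro ⟨φ, hφ⟩
    obtain ⟨w, hw⟩ : ∃ w, Cosets.mk H w = φ.symm (Cosets.mk K 1) := Quotient.exists_rep _
    refine ⟨w, ?_⟩
    ext x
    have h₁ : φ (Cosets.mk H (w * x)) = Cosets.mk K x := by
      have := Cosets.map_mulRight φ hφ x (Cosets.mk H w)
      rw [hw, Equiv.apply_symm_apply, ← hw] at this
      exact this.trans (congrArg (Cosets.mk K) (one_mul x))
    have h₂ : Cosets.mk K 1 = Cosets.mk K x ↔ Cosets.mk H w = Cosets.mk H (w * x) := by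
      rw [← h₁, hw, Equiv.symm_apply_eq]
    rw [Cosets.mk_eq_mk, Cosets.mk_eq_mk] at h₂
    rw [mem_conjBy, ← h₂, inv_one, mul_one]
  · rintro ⟨w, rfl⟩
    refine ⟨Quotient.congr (Equiv.mulLeft w⁻¹) fun g g' => ?_, ?_⟩
    · rw [QuotientGroup.rightRel_apply, QuotientGroup.rightRel_apply, mem_conjBy]
      simp [mul_assoc]
    · rintro i ⟨g⟩
      exact congrArg (Cosets.mk _) (mul_assoc w⁻¹ g _).symm

/-! ### Measurability on the space of Schreier graphs -/

theorem measurableSet_mem_subgroup {m : ℕ} (w : FreeGroup (Fin m)) :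
    MeasurableSet {H : SchreierSpace m | w ∈ H} :=
  MeasurableSpace.measurableSet_generateFrom ⟨w, rfl⟩

theorem measurable_schreierSpace {α : Type*} [MeasurableSpace α] {m : ℕ}
    {f : α → SchreierSpace m} (h : ∀ w, MeasurableSet {x | w ∈ f x}) : Measurable f := by
  refine measurable_generateFrom ?_
  rintro _ ⟨w, rfl⟩
  exact h w

theorem measurable_conjBy {m : ℕ} (w : FreeGroup (Fin m)) : Measurable (conjBy w) :=
  measurable_schreierSpace fun _ => measurableSet_mem_subgroup _

theorem measurableSet_eq_schreierSpace {α : Type*} [MeasurableSpace α] {m : ℕ}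
    {f g : α → SchreierSpace m} (hf : Measurable f) (hg : Measurable g) :
    MeasurableSet {x | f x = g x} := by
  simp only [SetLike.ext_iff, Set.ofPred_forall]
  exact MeasurableSet.iInter fun w =>
    (hf (measurableSet_mem_subgroup w)).iff (hg (measurableSet_mem_subgroup w))

theorem measurableSet_singleton_schreierSpace {m : ℕ} (H : SchreierSpace m) :
    MeasurableSet {H} :=
  measurableSet_eq_schreierSpace measurable_id measurable_const

/-! ### The mass transport principle -/

/-- The word `w` is the first one, in a fixed enumeration of the free group, that conjugates `H`
to `conjBy w H`. Each subgroup conjugate to `H` is thus `conjBy w H` for a unique such `w`. -/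
def IsFirstConj {m : ℕ} [Encodable (FreeGroup (Fin m))] (w : FreeGroup (Fin m))
    (H : SchreierSpace m) : Prop :=
  ∀ v, conjBy v H = conjBy w H → Encodable.encode w ≤ Encodable.encode v

theorem IsFirstConj.unique {m : ℕ} [Encodable (FreeGroup (Fin m))] {v w : FreeGroup (Fin m)}
    {H : SchreierSpace m} (hv : IsFirstConj v H) (hw : IsFirstConj w H)
    (h : conjBy v H = conjBy w H) : v = w :=
  Encodable.encode_injective (le_antisymm (hv w h.symm) (hw v h))

theorem exists_isFirstConj {m : ℕ} [Encodable (FreeGroup (Fin m))] (v : FreeGroup (Fin m))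
    (H : SchreierSpace m) : ∃ w, conjBy w H = conjBy v H ∧ IsFirstConj w H := by
  obtain ⟨w, hw, hmin⟩ := WellFounded.has_min
    (measure (Encodable.encode (α := FreeGroup (Fin m)))).wf
    {w | conjBy w H = conjBy v H} ⟨v, rfl⟩
  exact ⟨w, hw, fun x hx => not_lt.1 (hmin x (hx.trans hw))⟩

theorem measurableSet_isFirstConj {m : ℕ} [Encodable (FreeGroup (Fin m))]
    (w : FreeGroup (Fin m)) : MeasurableSet {H : SchreierSpace m | IsFirstConj w H} := by
  simp only [IsFirstConj, Set.ofPred_forall]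
  exact MeasurableSet.iInter fun v =>
    (measurableSet_eq_schreierSpace (measurable_conjBy v) (measurable_conjBy w)).imp
      (MeasurableSet.const _)

/-- The integral of the cardinality of a countable family of events. -/
theorem lintegral_encard_eq_tsum {α ι : Type*} [MeasurableSpace α] [Countable ι]
    (μ : Measure α) {B : ι → Set α} (hB : ∀ i, MeasurableSet (B i)) :
    ∫⁻ x, ({i | x ∈ B i}.encard : ℝ≥0∞) ∂μ = ∑' i, μ (B i) := by
  have h : ∀ x, ({i | x ∈ B i}.encard : ℝ≥0∞) = ∑' i, (B i).indicator 1 x := by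
    intro x
    rw [← ENNReal.tsum_set_one, tsum_subtype {i | x ∈ B i} fun _ => (1 : ℝ≥0∞)]
    rfl
  simp_rw [h]
  rw [lintegral_tsum fun i => (measurable_one.indicator (hB i)).aemeasurable]
  simp_rw [lintegral_indicator_one (hB _)]

/-- A conjugation-invariant measure is invariant. Both counting measures are the sum over `w` of
the mass of those `H` for which `(H, w⁻¹Hw)` lies in the given set and `w` is the first word
conjugating `H` to `w⁻¹Hw`; for the right counting measure this uses the substitution
`K = w⁻¹Hw`. -/
theorem isInvariantMeasure_of_conjBy {m : ℕ} {μ : Measure (SchreierSpace m)}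
    (hμ : ∀ w, MeasurePreserving (conjBy w) μ μ) : IsInvariantMeasure μ := by
  intro A hA
  let _ := Encodable.ofCountable (FreeGroup (Fin m))
  let B : FreeGroup (Fin m) → Set (SchreierSpace m) :=
    fun w => {H | (H, conjBy w H) ∈ A ∧ IsFirstConj w H}
  have hB : ∀ w, MeasurableSet (B w) := fun w =>
    ((measurable_id.prodMk (measurable_conjBy w)) hA).inter (measurableSet_isFirstConj w)
  have hl : leftCounting μ A = ∑' w, μ (B w) := by
    rw [← lintegral_encard_eq_tsum μ hB, leftCounting]
    refine lintegral_congr fun H => ?_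
    have hS : {K | UnrootedIso H K ∧ (H, K) ∈ A} = (fun w => conjBy w H) '' {w | H ∈ B w} := by
      ext K
      constructor
      · rintro ⟨hK, hA⟩
        obtain ⟨v, rfl⟩ := unrootedIso_iff.1 hK
        obtain ⟨w, hw, hf⟩ := exists_isFirstConj v H
        exact ⟨w, ⟨by rwa [hw], hf⟩, hw⟩
      · rintro ⟨w, hw, rfl⟩
        exact ⟨unrootedIso_iff.2 ⟨w, rfl⟩, hw.1⟩
    rw [hS, Set.InjOn.encard_image]
    exact fun v hv w hw h => hv.2.unique hw.2 h
  have hr : rightCounting μ A = ∑' w, μ (conjBy w⁻¹ ⁻¹' B w) := by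
    rw [← lintegral_encard_eq_tsum μ fun w => measurable_conjBy _ (hB w), rightCounting]
    refine lintegral_congr fun K => ?_
    have hS : {H | UnrootedIso H K ∧ (H, K) ∈ A} =
        (fun w => conjBy w⁻¹ K) '' {w | K ∈ conjBy w⁻¹ ⁻¹' B w} := by
      ext H
      constructor
      · rintro ⟨hK, hA⟩
        obtain ⟨v, rfl⟩ := unrootedIso_iff.1 hK
        obtain ⟨w, hw, hf⟩ := exists_isFirstConj v H
        have hH : conjBy w⁻¹ (conjBy v H) = H := conjBy_inv_eq_iff.2 hw
        refine ⟨w, ?_, hH⟩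
        change conjBy w⁻¹ (conjBy v H) ∈ B w
        rw [hH]
        exact ⟨by rwa [hw], hf⟩
      · rintro ⟨w, hw, rfl⟩
        have hK : conjBy w (conjBy w⁻¹ K) = K := conjBy_inv_eq_iff.1 rfl
        exact ⟨unrootedIso_iff.2 ⟨w, hK⟩, by simpa only [hK] using hw.1⟩
    rw [hS, Set.InjOn.encard_image]
    intro v hv w hw h
    have hv' : IsFirstConj v (conjBy v⁻¹ K) := hv.2
    have hw' : IsFirstConj w (conjBy w⁻¹ K) := hw.2
    have h' : conjBy v⁻¹ K = conjBy w⁻¹ K := h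
    rw [← h'] at hw'
    refine hv'.unique hw' ?_
    rw [conjBy_inv_eq_iff.1 rfl, h', conjBy_inv_eq_iff.1 rfl]
  rw [hl, hr]
  exact tsum_congr fun w => ((hμ w⁻¹).measure_preimage (hB w).nullMeasurableSet).symm

/-- Invariance has to be checked only for the conjugations by the generators. -/
theorem measurePreserving_conjBy_of_generators {m : ℕ} {μ : Measure (SchreierSpace m)}
    (h : ∀ i, MeasurePreserving (conjBy (FreeGroup.of i)) μ μ) (w : FreeGroup (Fin m)) :
    MeasurePreserving (conjBy w) μ μ := by
  induction w using FreeGroup.induction_on with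
  | C1 =>
    rw [show conjBy (1 : FreeGroup (Fin m)) = id from funext conjBy_one]
    exact MeasurePreserving.id μ
  | of i => exact h i
  | inv_of i _ =>
    refine ⟨measurable_conjBy _, ?_⟩
    conv_lhs => rw [← (h i).map_eq]
    rw [Measure.map_map (measurable_conjBy _) (measurable_conjBy _)]
    rw [show conjBy (FreeGroup.of i)⁻¹ ∘ conjBy (FreeGroup.of i) = id from
      funext fun H => conjBy_inv_eq_iff.2 rfl, Measure.map_id]
  | mul x y hx hy =>
    rw [show conjBy (x * y) = conjBy y ∘ conjBy x from funext fun H => (conjBy_conjBy x y H).symm]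
    exact hy.comp hx

/-! ### Reading words in a Schreier structure -/

/-- The permutation that moves each vertex along the path labelled by `w`. -/
def walk {V : Type*} {m : ℕ} (σ : Fin m → Equiv.Perm V) (w : FreeGroup (Fin m)) :
    Equiv.Perm V :=
  MulOpposite.unop (FreeGroup.lift (fun i => MulOpposite.op (σ i)) w)

theorem walk_one {V : Type*} {m : ℕ} (σ : Fin m → Equiv.Perm V) (x : V) : walk σ 1 x = x := by
  simp [walk]

theorem walk_of {V : Type*} {m : ℕ} (σ : Fin m → Equiv.Perm V) (i : Fin m) (x : V) :
    walk σ (FreeGroup.of i) x = σ i x := by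
  simp [walk]

theorem walk_mul {V : Type*} {m : ℕ} (σ : Fin m → Equiv.Perm V) (v w : FreeGroup (Fin m))
    (x : V) : walk σ (v * w) x = walk σ w (walk σ v x) := by
  simp [walk]

theorem walk_inv {V : Type*} {m : ℕ} (σ : Fin m → Equiv.Perm V) (w : FreeGroup (Fin m))
    (x : V) : walk σ w⁻¹ x = (walk σ w).symm x := by
  rw [Equiv.eq_symm_apply, ← walk_mul, inv_mul_cancel, walk_one]

theorem mem_fundamentalGroup {V : Type u} {m : ℕ} {σ : Fin m → Equiv.Perm V} {o : V}
    {w : FreeGroup (Fin m)} : w ∈ fundamentalGroup σ o ↔ walk σ w o = o :=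
  Iff.rfl

theorem mul_inv_mem_fundamentalGroup {V : Type u} {m : ℕ} {σ : Fin m → Equiv.Perm V} {o : V}
    {v w : FreeGroup (Fin m)} :
    v * w⁻¹ ∈ fundamentalGroup σ o ↔ walk σ v o = walk σ w o := by
  rw [mem_fundamentalGroup, walk_mul, walk_inv, Equiv.symm_apply_eq]

theorem conjBy_fundamentalGroup {V : Type u} {m : ℕ} (σ : Fin m → Equiv.Perm V) (o : V)
    (w : FreeGroup (Fin m)) :
    conjBy w (fundamentalGroup σ o) = fundamentalGroup σ (walk σ w o) := by
  ext x
  rw [mem_conjBy, mul_inv_mem_fundamentalGroup, walk_mul, mem_fundamentalGroup]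

theorem walk_map {V W : Type*} {m : ℕ} {σ : Fin m → Equiv.Perm V} {τ : Fin m → Equiv.Perm W}
    (φ : V ≃ W) (h : ∀ i x, φ (σ i x) = τ i (φ x)) (w : FreeGroup (Fin m)) :
    ∀ x, φ (walk σ w x) = walk τ w (φ x) := by
  induction w using FreeGroup.induction_on with
  | C1 => intro x; rw [walk_one, walk_one]
  | of i => intro x; rw [walk_of, walk_of, h]
  | inv_of i ih =>
    intro x
    rw [walk_inv τ, Equiv.eq_symm_apply, ← ih, ← walk_mul, inv_mul_cancel, walk_one]
  | mul v w hv hw => intro x; rw [walk_mul, walk_mul, hw, hv]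

theorem fundamentalGroup_map {V W : Type u} {m : ℕ} {σ : Fin m → Equiv.Perm V}
    {τ : Fin m → Equiv.Perm W} (φ : V ≃ W) (h : ∀ i x, φ (σ i x) = τ i (φ x)) (o : V) :
    fundamentalGroup τ (φ o) = fundamentalGroup σ o := by
  ext w
  rw [mem_fundamentalGroup, mem_fundamentalGroup, ← walk_map φ h, φ.apply_eq_iff_eq]

/-! ### Underlying graphs -/

theorem underlyingGraph_isLink_iff {V : Type u} {m : ℕ} {σ : Fin m → Equiv.Perm V}
    {e : V × Fin m} {x y : V} :
    (underlyingGraph σ).IsLink e x y ↔ s(x, y) = s(e.1, σ e.2 e.1) := by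
  rw [Sym2.eq_iff]
  refine or_congr Iff.rfl ?_
  exact and_comm

theorem mem_edgeSet_underlyingGraph {V : Type u} {m : ℕ} {σ : Fin m → Equiv.Perm V}
    (e : V × Fin m) : e ∈ (underlyingGraph σ).edgeSet :=
  ⟨e.1, σ e.2 e.1, Or.inl ⟨rfl, rfl⟩⟩

/-- Bijections of the vertices and of the edges that match the unordered pairs of endpoints give an
isomorphism of the underlying rooted graphs. -/
theorem underlyingRooted_iso {V W : Type u} {m : ℕ} {σ : Fin m → Equiv.Perm V}
    {τ : Fin m → Equiv.Perm W} {o : V} {o' : W} (φ : V ≃ W) (ψ : V × Fin m ≃ W × Fin m)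
    (ho : φ o = o')
    (h : ∀ x i, s((ψ (x, i)).1, τ (ψ (x, i)).2 (ψ (x, i)).1) = s(φ x, φ (σ i x))) :
    (underlyingRooted σ o).Iso (underlyingRooted τ o') := by
  refine ⟨φ.subtypeEquiv fun _ => Iff.rfl, ψ.subtypeEquiv fun e =>
    iff_of_true (mem_edgeSet_underlyingGraph e) (mem_edgeSet_underlyingGraph (ψ e)),
    Subtype.ext ho, ?_⟩
  have key : ∀ (e : V × Fin m) (x y : V),
      (underlyingGraph σ).IsLink e x y ↔ (underlyingGraph τ).IsLink (ψ e) (φ x) (φ y) := by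
    intro e x y
    rw [underlyingGraph_isLink_iff, underlyingGraph_isLink_iff, h e.1 e.2]
    have hinj := Sym2.map.injective φ.injective
    exact (hinj.eq_iff (a := s(x, y)) (b := s(e.1, σ e.2 e.1))).symm
  exact fun e x y => key e.1 x.1 y.1

/-- The Schreier graph of the fundamental group of a connected rooted Schreier structure has the
same underlying rooted graph as that structure: the coset of a word is its endpoint. -/
theorem underlyingRooted_fundamentalGroup_iso {V : Type u} {m : ℕ} (σ : Fin m → Equiv.Perm V)
    (o : V) (hσ : ∀ v, ∃ w, walk σ w o = v) :
    (underlyingRooted (schreierStep.{u} (fundamentalGroup σ o))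
      (ULift.up (Cosets.mk _ 1))).Iso (underlyingRooted σ o) := by
  let f : Cosets (fundamentalGroup σ o) → V := Quotient.lift (fun w => walk σ w o) fun v w h => by
    change QuotientGroup.rightRel _ _ _ at h
    rw [QuotientGroup.rightRel_apply, mul_inv_mem_fundamentalGroup] at h
    exact h.symm
  have hf : Function.Bijective f := by
    refine ⟨?_, fun v => ?_⟩
    · rintro ⟨v⟩ ⟨w⟩ (h : walk σ v o = walk σ w o)
      exact Cosets.mk_eq_mk.2 (mul_inv_mem_fundamentalGroup.2 h.symm)
    · obtain ⟨w, hw⟩ := hσ v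
      exact ⟨Cosets.mk _ w, hw⟩
  let φ : ULift.{u} (Cosets (fundamentalGroup σ o)) ≃ V :=
    Equiv.ulift.trans (Equiv.ofBijective f hf)
  have hφ : ∀ i x, φ (schreierStep _ i x) = σ i (φ x) := by
    rintro i ⟨⟨w⟩⟩
    exact (walk_mul σ w (FreeGroup.of i) o).trans (walk_of σ i _)
  refine underlyingRooted_iso φ (Equiv.prodCongr φ (Equiv.refl _)) (walk_one σ o) fun x i => ?_
  rw [hφ]
  rfl

/-! ### Random configurations -/

/-- The action by left translation on `Bool`-valued configurations on the left cosets of `H`. -/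
def shift {G : Type u} [Group G] {H : Subgroup G} (g : G) (ω : G ⧸ H → Bool) : G ⧸ H → Bool :=
  fun q => ω (g • q)

theorem measurable_shift {G : Type u} [Group G] {H : Subgroup G} (g : G) :
    Measurable (shift (H := H) g) :=
  measurable_pi_lambda _ fun _ => measurable_pi_apply _

/-- An independent identically distributed configuration is invariant under translations. -/
theorem measurePreserving_shift {G : Type u} [Group G] {H : Subgroup G} (ν : Measure Bool)
    [IsProbabilityMeasure ν] (g : G) :
    MeasurePreserving (shift (H := H) g) (Measure.infinitePi fun _ => ν)
      (Measure.infinitePi fun _ => ν) := by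
  refine ⟨measurable_shift g, ?_⟩
  convert Measure.infinitePi_map_piCongrLeft (fun _ : G ⧸ H => ν) (MulAction.toPerm g⁻¹) using 2
  ext ω q
  obtain ⟨q, rfl⟩ := (MulAction.toPerm g⁻¹ : Equiv.Perm (G ⧸ H)).surjective q
  rw [MeasurableEquiv.coe_piCongrLeft, Equiv.piCongrLeft_apply_apply]
  simp [shift]

/-- Translating an independent identically distributed configuration by an element of `H` that
depends on the value at the coset `H` preserves its law, because `H` fixes this coset. -/
theorem measurePreserving_shift_of_base {G : Type u} [Group G] {H : Subgroup G}
    (ν : Measure Bool) [IsProbabilityMeasure ν] (u : Bool → H) :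
    MeasurePreserving (fun ω : G ⧸ H → Bool => shift (u (ω (1 : G)) : G) ω)
      (Measure.infinitePi fun _ => ν) (Measure.infinitePi fun _ => ν) := by
  have hfix : ∀ (h : H) (ω : G ⧸ H → Bool), shift (h : G) ω (1 : G) = ω (1 : G) := by
    intro h ω
    refine congrArg ω (QuotientGroup.eq.2 ?_)
    simp
  have hE : ∀ b : Bool, MeasurableSet {ω : G ⧸ H → Bool | ω (1 : G) = b} := fun b =>
    measurableSet_eq_fun (measurable_pi_apply _) measurable_const
  have hpre : ∀ (B : Set (G ⧸ H → Bool)) (b : Bool),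
      (fun ω : G ⧸ H → Bool => shift (u (ω (1 : G)) : G) ω) ⁻¹' B ∩ {ω | ω (1 : G) = b} =
        shift (u b : G) ⁻¹' (B ∩ {ω | ω (1 : G) = b}) := by
    intro B b
    ext ω
    simp only [Set.mem_inter_iff, Set.mem_preimage, Set.mem_ofPred_eq, hfix]
    constructor <;> rintro ⟨h, rfl⟩ <;> exact ⟨h, rfl⟩
  have hdiff : ∀ B : Set (G ⧸ H → Bool), B \ {ω | ω (1 : G) = true} =
      B ∩ {ω | ω (1 : G) = false} := by
    intro B
    ext ω
    simp
  have hmeas : Measurable fun ω : G ⧸ H → Bool => shift (u (ω (1 : G)) : G) ω := by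
    intro B hB
    rw [← Set.inter_union_sdiff (_ ⁻¹' B) {ω : G ⧸ H → Bool | ω (1 : G) = true}, hdiff, hpre, hpre]
    exact (measurable_shift _ (hB.inter (hE _))).union (measurable_shift _ (hB.inter (hE _)))
  refine ⟨hmeas, Measure.ext fun B hB => ?_⟩
  rw [Measure.map_apply hmeas hB, ← measure_inter_add_sdiff _ (hE true), hdiff, hpre, hpre,
    (measurePreserving_shift ν _).measure_preimage (hB.inter (hE _)).nullMeasurableSet,
    (measurePreserving_shift ν _).measure_preimage (hB.inter (hE _)).nullMeasurableSet,
    ← hdiff, measure_inter_add_sdiff _ (hE true)]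

/-- An infinite product of copies of a measure whose atoms are bounded away from `1` has no
atoms. -/
theorem infinitePi_singleton_eq_zero {ι X : Type*} [Infinite ι] [MeasurableSpace X]
    [MeasurableSingletonClass X] (ν : Measure X) [IsProbabilityMeasure ν] {r : ℝ≥0∞} (hr : r < 1)
    (hν : ∀ x, ν {x} ≤ r) (f : ι → X) : Measure.infinitePi (fun _ : ι => ν) {f} = 0 := by
  refine le_antisymm ?_ bot_le
  refine ge_of_tendsto' (ENNReal.tendsto_pow_atTop_nhds_zero_of_lt_one hr) fun k => ?_
  obtain ⟨s, hs⟩ := Infinite.exists_subset_card_eq ι k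
  calc Measure.infinitePi (fun _ : ι => ν) {f}
      ≤ Measure.infinitePi (fun _ : ι => ν) (Set.pi s fun i => {f i}) := by
        refine measure_mono ?_
        rintro _ rfl i _
        rfl
    _ = ∏ i ∈ s, ν {f i} := Measure.infinitePi_pi _ fun i _ => measurableSet_singleton _
    _ ≤ r ^ k := hs ▸ Finset.prod_le_pow_card _ _ _ fun i _ => hν _

theorem bernoulliMeasure_singleton_le {p : unitInterval} (h₀ : 0 < p) (h₁ : p < 1) :
    ∃ r < 1, ∀ b, ProbabilityTheory.bernoulliMeasure true false p {b} ≤ r := by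
  set ν := ProbabilityTheory.bernoulliMeasure true false p with hν
  have ht : ν {true} < 1 := by
    rw [hν, ProbabilityTheory.bernoulliMeasure_apply_of_mem_of_notMem p (by simp) (by simp)
      (by simp)]
    exact_mod_cast h₁
  have hf : ν {false} < 1 := by
    rw [hν, ProbabilityTheory.bernoulliMeasure_apply_of_notMem_of_mem p (by simp) (by simp)
      (by simp)]
    have h : unitInterval.symm p < 1 := by
      rw [← unitInterval.symm_zero]
      exact unitInterval.symm_lt_symm.2 h₀
    exact_mod_cast h
  refine ⟨max (ν {true}) (ν {false}), max_lt ht hf, ?_⟩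
  rintro (_ | _)
  exacts [le_max_right _ _, le_max_left _ _]

/-! ### Randomly twisted Cayley graphs -/

/-- The permutation `x ↦ x * u (ω (xH))` of `G`; it preserves each left coset of `H`. -/
def cosetTwist {G : Type u} [Group G] {H : Subgroup G} (u : Bool → H) (ω : G ⧸ H → Bool) :
    Equiv.Perm G where
  toFun x := x * u (ω x)
  invFun x := x * (u (ω x))⁻¹
  left_inv x := by
    have h : ((x * (u (ω x) : G) : G) : G ⧸ H) = x := QuotientGroup.mk_mul_of_mem x (u (ω x)).2
    simp [h]
  right_inv x := by
    have h : ((x * (u (ω x) : G)⁻¹ : G) : G ⧸ H) = x :=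
      QuotientGroup.mk_mul_of_mem x (inv_mem (u (ω x)).2)
    simp [h]

/-- A Schreier structure on `G` that depends on a configuration `ω` on the left cosets of `H`: the
edge labelled `i` leads from `x` to `x * u i (ω (xH)) * t i`. -/
def twistedStep {G : Type u} [Group G] {H : Subgroup G} {m : ℕ} (u : Fin m → Bool → H)
    (t : Fin m → G) (ω : G ⧸ H → Bool) (i : Fin m) : Equiv.Perm G :=
  (cosetTwist (u i) ω).trans (Equiv.mulRight (t i))

theorem twistedStep_apply {G : Type u} [Group G] {H : Subgroup G} {m : ℕ} (u : Fin m → Bool → H)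
    (t : Fin m → G) (ω : G ⧸ H → Bool) (i : Fin m) (x : G) :
    twistedStep u t ω i x = x * u i (ω x) * t i :=
  rfl

/-- The twisted Schreier graph rooted at the identity. -/
def twistedSchreier {G : Type u} [Group G] {H : Subgroup G} {m : ℕ} (u : Fin m → Bool → H)
    (t : Fin m → G) (ω : G ⧸ H → Bool) : SchreierSpace m :=
  fundamentalGroup (twistedStep u t ω) (1 : G)

/-- Moving the root to the vertex `v` amounts to translating the configuration by `v`. -/
theorem fundamentalGroup_twistedStep {G : Type u} [Group G] {H : Subgroup G} {m : ℕ}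
    (u : Fin m → Bool → H) (t : Fin m → G) (ω : G ⧸ H → Bool) (v : G) :
    fundamentalGroup (twistedStep u t ω) v = twistedSchreier u t (shift v ω) := by
  have h : ∀ i x, v * twistedStep u t (shift v ω) i x = twistedStep u t ω i (v * x) := by
    intro i x
    rw [twistedStep_apply, twistedStep_apply, mul_assoc, mul_assoc, mul_assoc]
    rfl
  exact (congrArg _ (mul_one v).symm).trans (fundamentalGroup_map (Equiv.mulLeft v) h 1)

theorem conjBy_of_twistedSchreier {G : Type u} [Group G] {H : Subgroup G} {m : ℕ}
    (u : Fin m → Bool → H) (t : Fin m → G) (ω : G ⧸ H → Bool) (i : Fin m) :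
    conjBy (FreeGroup.of i) (twistedSchreier u t ω) =
      twistedSchreier u t (shift (t i) (shift (u i (ω (1 : G)) : G) ω)) := by
  rw [twistedSchreier, conjBy_fundamentalGroup, walk_of, fundamentalGroup_twistedStep,
    twistedStep_apply, one_mul]
  refine congrArg _ (funext fun q => congrArg ω ?_)
  exact mul_smul _ _ q

/-- In a Schreier structure that depends on a parameter in a locally constant way, so does the
endpoint of a path with given labels. -/
theorem isLocallyConstant_walk {X V : Type*} [TopologicalSpace X] {m : ℕ}
    {σ : X → Fin m → Equiv.Perm V} (h : ∀ i x, IsLocallyConstant fun ω => σ ω i x)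
    (w : FreeGroup (Fin m)) : ∀ x, IsLocallyConstant fun ω => walk (σ ω) w x := by
  simp only [IsLocallyConstant.iff_eventually_eq] at h ⊢
  induction w using FreeGroup.induction_on with
  | C1 => intro x ω; simp only [walk_one, Filter.eventually_true]
  | of i => intro x ω; simpa only [walk_of] using h i x ω
  | inv_of i _ =>
    intro x ω
    filter_upwards [h i ((σ ω i).symm x) ω] with ω' h'
    have hsymm : ∀ ω, walk (σ ω) (FreeGroup.of i)⁻¹ x = (σ ω i).symm x := by
      intro ω
      rw [walk_inv, Equiv.symm_apply_eq, walk_of, Equiv.apply_symm_apply]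
    rw [hsymm, hsymm, Equiv.symm_apply_eq, h', Equiv.apply_symm_apply]
  | mul v w hv hw =>
    intro x ω
    filter_upwards [hv x ω, hw (walk (σ ω) v x) ω] with ω' h₁ h₂
    rw [walk_mul, walk_mul, h₁, h₂]

theorem isLocallyConstant_twistedStep {G : Type u} [Group G] {H : Subgroup G} {m : ℕ}
    (u : Fin m → Bool → H) (t : Fin m → G) (i : Fin m) (x : G) :
    IsLocallyConstant fun ω : G ⧸ H → Bool => twistedStep u t ω i x :=
  have h : IsLocallyConstant fun ω : G ⧸ H → Bool => ω x :=
    (IsLocallyConstant.iff_continuous _).2 (continuous_apply _)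
  h.comp fun b => x * u i b * t i

theorem isClopen_mem_twistedSchreier {G : Type u} [Group G] {H : Subgroup G} {m : ℕ}
    (u : Fin m → Bool → H) (t : Fin m → G) (w : FreeGroup (Fin m)) :
    IsClopen {ω : G ⧸ H → Bool | w ∈ twistedSchreier u t ω} :=
  (isLocallyConstant_walk (isLocallyConstant_twistedStep u t) w 1).isClopen_fiber 1

theorem measurable_twistedSchreier {G : Type u} [Group G] [Countable G] {H : Subgroup G} {m : ℕ}
    (u : Fin m → Bool → H) (t : Fin m → G) : Measurable (twistedSchreier u t) :=
  have : Countable (G ⧸ H) := Quotient.mk_surjective.countable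
  measurable_schreierSpace fun w => (isClopen_mem_twistedSchreier u t w).isOpen.measurableSet

/-- The range is the continuous image of a compact space, hence closed. -/
theorem measurableSet_range_twistedSchreier {G : Type u} [Group G] {H : Subgroup G} {m : ℕ}
    (u : Fin m → Bool → H) (t : Fin m → G) :
    MeasurableSet (Set.range (twistedSchreier u t)) := by
  classical
  let ι : SchreierSpace m → FreeGroup (Fin m) → Bool := fun K w => decide (w ∈ K)
  have hι : Measurable ι := measurable_pi_lambda _ fun w => measurable_to_bool (by
    convert measurableSet_mem_subgroup w using 1
    ext K
    simp [ι])
  have hinj : Function.Injective ι := by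
    intro K L h
    ext w
    have := congrFun h w
    simpa [ι] using this
  have hcont : Continuous (ι ∘ twistedSchreier u t) := by
    refine continuous_pi fun w => ?_
    refine continuous_bool_rng true |>.2 ?_
    convert isClopen_mem_twistedSchreier u t w using 1
    ext ω
    simp [ι]
  have := hι (isCompact_range hcont).isClosed.measurableSet
  rwa [Set.range_comp, hinj.preimage_image] at this

/-- The law of the twisted Schreier graph for an independent Bernoulli configuration. -/
noncomputable def twistedMeasure {G : Type u} [Group G] {H : Subgroup G} {m : ℕ}
    (u : Fin m → Bool → H) (t : Fin m → G) (p : unitInterval) : Measure (SchreierSpace m) :=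
  (Measure.infinitePi fun _ : G ⧸ H =>
    ProbabilityTheory.bernoulliMeasure true false p).map (twistedSchreier u t)

theorem isInvariantMeasure_twistedMeasure {G : Type u} [Group G] [Countable G] {H : Subgroup G}
    {m : ℕ} (u : Fin m → Bool → H) (t : Fin m → G) (p : unitInterval) :
    IsInvariantMeasure (twistedMeasure u t p) := by
  refine isInvariantMeasure_of_conjBy (measurePreserving_conjBy_of_generators fun i => ?_)
  refine ⟨measurable_conjBy _, ?_⟩
  have hR := measurable_twistedSchreier u t
  have hT := (measurePreserving_shift (H := H)
    (ProbabilityTheory.bernoulliMeasure true false p) (t i)).comp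
      (measurePreserving_shift_of_base _ (u i))
  rw [twistedMeasure, Measure.map_map (measurable_conjBy _) hR,
    show conjBy (FreeGroup.of i) ∘ twistedSchreier u t = twistedSchreier u t ∘
      (shift (t i) ∘ fun ω => shift (u i (ω (1 : G)) : G) ω) from
      funext fun ω => conjBy_of_twistedSchreier u t ω i,
    ← Measure.map_map hR hT.measurable, hT.map_eq]

/-- Along labels `e j` that carry the untwisted generators `a j`, words are read as in the Cayley
graph. -/
theorem walk_twistedStep_map {G : Type u} [Group G] {H : Subgroup G} {n m : ℕ}
    {u : Fin m → Bool → H} {t : Fin m → G} {a : Fin n → G} {e : Fin n → Fin m}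
    (he : ∀ j b, (u (e j) b : G) * t (e j) = a j) (ω : G ⧸ H → Bool)
    (w : FreeGroup (Fin n)) :
    ∀ x, walk (twistedStep u t ω) (FreeGroup.map e w) x = x * FreeGroup.lift a w := by
  induction w using FreeGroup.induction_on with
  | C1 => intro x; simp [walk_one]
  | of j =>
    intro x
    rw [FreeGroup.map.of, walk_of, twistedStep_apply, mul_assoc, he, FreeGroup.lift_apply_of]
  | inv_of j ih =>
    intro x
    rw [map_inv, walk_inv, Equiv.symm_apply_eq, ih, map_inv, inv_mul_cancel_right]
  | mul v w hv hw =>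
    intro x
    rw [map_mul, walk_mul, hv, hw, map_mul, mul_assoc]

theorem lift_surjective_of_closure_eq_top {G : Type u} [Group G] {n : ℕ} {a : Fin n → G}
    (ha : Subgroup.closure (Set.range a) = ⊤) :
    Function.Surjective (FreeGroup.lift a) := by
  rw [← MonoidHom.range_eq_top, FreeGroup.range_lift_eq_closure, ha]

/-- The configuration can be recovered from the twisted Schreier graph: untwisted labels lead to
any vertex `x`, and whether the path through the edge labelled `i` at `x` closes up decides
`ω (xH)`. -/
theorem twistedSchreier_injective {G : Type u} [Group G] {H : Subgroup G} {n m : ℕ}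
    {u : Fin m → Bool → H} {t : Fin m → G} {a : Fin n → G}
    (ha : Subgroup.closure (Set.range a) = ⊤) {e : Fin n → Fin m}
    (he : ∀ j b, (u (e j) b : G) * t (e j) = a j) {i : Fin m}
    (hi : Function.Injective (u i)) : Function.Injective (twistedSchreier u t) := by
  intro ω ω' h
  ext q
  obtain ⟨x, rfl⟩ := QuotientGroup.mk_surjective q
  obtain ⟨v, hv⟩ := lift_surjective_of_closure_eq_top ha x
  obtain ⟨w, hw⟩ := lift_surjective_of_closure_eq_top ha (x * u i (ω x) * t i)
  have key : ∀ η : G ⧸ H → Bool,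
      FreeGroup.map e v * FreeGroup.of i * (FreeGroup.map e w)⁻¹ ∈ twistedSchreier u t η ↔
        x * u i (η x) * t i = x * u i (ω x) * t i := by
    intro η
    rw [twistedSchreier, mul_inv_mem_fundamentalGroup, walk_mul, walk_twistedStep_map he,
      walk_twistedStep_map he, walk_of, one_mul, one_mul, hv, hw, twistedStep_apply]
  have h' := (key ω').1 (h ▸ (key ω).2 rfl)
  exact (hi (Subtype.ext (mul_left_cancel (mul_right_cancel h')))).symm

/-- If some labels carry an untwisted generating family `a`, some other label determines the
configuration, and the twisted graph is always isomorphic, as an unlabelled rooted graph, to the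
Cayley graph for the family `s`, then the law of the twisted Schreier graph is a nonatomic invariant
lift. -/
theorem isNonatomicInvariantLift_twistedMeasure {G : Type u} [Group G] {H : Subgroup G}
    [Infinite (G ⧸ H)] {n m : ℕ} {u : Fin m → Bool → H} {t : Fin m → G} {a : Fin n → G}
    (ha : Subgroup.closure (Set.range a) = ⊤) {e : Fin n → Fin m}
    (he : ∀ j b, (u (e j) b : G) * t (e j) = a j) {i : Fin m}
    (hi : Function.Injective (u i)) {p : unitInterval} (h₀ : 0 < p) (h₁ : p < 1)
    {s : Fin m → G} (hs : Subgroup.closure (Set.range s) = ⊤)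
    (hiso : ∀ ω, (underlyingRooted (twistedStep u t ω) (1 : G)).Iso
      (underlyingRooted (fun i => Equiv.mulRight (s i)) (1 : G))) :
    IsNonatomicInvariantLift (twistedMeasure u t p) (cayleyGraph s hs) := by
  have : Countable G := (lift_surjective_of_closure_eq_top ha).countable
  have hR := measurable_twistedSchreier u t
  have hprob : IsProbabilityMeasure (twistedMeasure u t p) :=
    Measure.isProbabilityMeasure_map hR.aemeasurable
  refine ⟨hprob, fun K => ?_, isInvariantMeasure_twistedMeasure u t p, ?_⟩
  · rw [twistedMeasure, Measure.map_apply hR (measurableSet_singleton_schreierSpace K)]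
    rcases (Set.subsingleton_singleton.preimage
      (twistedSchreier_injective ha he hi)).eq_empty_or_singleton with h | ⟨ω, h⟩
    · rw [h, measure_empty]
    · obtain ⟨r, hr, hν⟩ := bernoulliMeasure_singleton_le h₀ h₁
      rw [h, infinitePi_singleton_eq_zero _ hr hν]
  · have hforget : ∀ ω, forget.{u} (twistedSchreier u t ω) = cayleyGraph s hs := by
      intro ω
      refine Quotient.sound ((underlyingRooted_fundamentalGroup_iso _ _ fun v => ?_).trans (hiso ω))
      obtain ⟨w, hw⟩ := lift_surjective_of_closure_eq_top ha v
      exact ⟨FreeGroup.map e w, by rw [walk_twistedStep_map he, one_mul, hw]⟩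
    have hae : forget.{u} =ᵐ[twistedMeasure u t p] fun _ => cayleyGraph s hs := by
      have hrange : Set.range (twistedSchreier u t) ∈ ae (twistedMeasure u t p) := by
        rw [twistedMeasure, mem_ae_map_iff hR.aemeasurable
          (measurableSet_range_twistedSchreier u t)]
        exact Filter.Eventually.of_forall fun ω => ⟨ω, rfl⟩
      filter_upwards [hrange] with K hK
      obtain ⟨ω, rfl⟩ := hK
      exact hforget ω
    rw [Measure.map_congr hae, Measure.map_const, measure_univ, one_smul]

/-! ### Reversing cycles and exchanging labels -/

theorem reversalMeasure_eq_twistedMeasure {G : Type u} [Group G] {n : ℕ} (a : Fin n → G) (c : G)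
    (p : unitInterval) :
    reversalMeasure a c p = twistedMeasure (H := Subgroup.zpowers c)
      (Fin.append (fun _ _ => 1)
        ![fun b => bif b then ⟨c⁻¹, inv_mem (Subgroup.mem_zpowers c)⟩
          else ⟨c, Subgroup.mem_zpowers c⟩])
      (Fin.append a ![1]) p := by
  refine congrArg (fun f => Measure.map f _) (funext fun ω => ?_)
  refine congrArg (fun σ => fundamentalGroup σ 1) (funext fun i => ?_)
  ext x
  rw [twistedStep_apply]
  refine Fin.addCases (fun j => ?_) (fun j => ?_) i
  · simp
  · simp only [Fin.append_right, Matrix.cons_val_fin_one, mul_one]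
    change (if ω x = true then x * c⁻¹ else x * c) = _
    cases ω x <;> rfl

/-- Reversing the orientations of random `c`-cycles yields a nonatomic invariant lift. The
configuration can be recovered because the two directions of a `c`-cycle differ, `c² ≠ 1`. -/
theorem isNonatomicInvariantLift_reversalMeasure {G : Type u} [Group G] {n : ℕ} {a : Fin n → G}
    (ha : Subgroup.closure (Set.range a) = ⊤) {c : G} [Infinite (G ⧸ Subgroup.zpowers c)]
    (hc : c ^ 2 ≠ 1) {p : unitInterval} (h₀ : 0 < p) (h₁ : p < 1) :
    IsNonatomicInvariantLift (reversalMeasure a c p)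
      (cayleyGraph (Fin.append a ![c]) (closure_append ha ![c])) := by
  rw [reversalMeasure_eq_twistedMeasure]
  refine isNonatomicInvariantLift_twistedMeasure ha (e := Fin.castAdd 1) (fun j b => by simp)
    (i := Fin.natAdd n 0) ?_ h₀ h₁ _ fun ω => ?_
  · have hne : c ≠ c⁻¹ := fun h => hc (by rw [sq]; exact mul_eq_one_iff_eq_inv.2 h)
    rintro (_ | _) (_ | _) h
    · rfl
    · exact absurd (congrArg Subtype.val h) (by simpa using hne)
    · exact absurd (congrArg Subtype.val h) (by simpa using hne.symm)
    · rfl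
  · -- The reversed edge at `x` is the edge of the Cayley graph that starts at `x * c⁻¹`.
    let r : Equiv.Perm G := cosetTwist (fun b => bif b then
      ⟨c⁻¹, inv_mem (Subgroup.mem_zpowers c)⟩ else (1 : Subgroup.zpowers c)) ω
    refine underlyingRooted_iso (Equiv.refl G)
      (Equiv.prodCongrLeft (Fin.append (fun _ => Equiv.refl G) ![r])) rfl fun x i => ?_
    refine Fin.addCases (fun j => ?_) (fun j => ?_) i
    · simp [twistedStep_apply]
    · have hr : r x = x * ((bif ω x then ⟨c⁻¹, inv_mem (Subgroup.mem_zpowers c)⟩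
        else (1 : Subgroup.zpowers c) : Subgroup.zpowers c) : G) := rfl
      simp only [Equiv.prodCongrLeft_apply, Fin.append_right, Matrix.cons_val_fin_one,
        Equiv.refl_apply, twistedStep_apply, mul_one, Equiv.coe_mulRight, hr]
      cases ω x
      · simp
      · simp

/-- Adjoin the generators `t` and `z * t`, and exchange their labels on the edges that start in a
coset of `⟨z⟩`, independently for each coset. This gives a Schreier structure because `x ↦ x * t` and
`x ↦ x * (z * t)` map `x⟨z⟩` onto the same set. -/
theorem exists_isNonatomicInvariantLift_append {G : Type u} [Group G] {n : ℕ} {a : Fin n → G}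
    (ha : Subgroup.closure (Set.range a) = ⊤) {z : G} (hz : z ≠ 1)
    [Infinite (G ⧸ Subgroup.zpowers z)] (t : G) :
    ∃ μ, IsNonatomicInvariantLift μ
      (cayleyGraph (Fin.append a ![t, z * t]) (closure_append ha ![t, z * t])) := by
  let z' : Subgroup.zpowers z := ⟨z, Subgroup.mem_zpowers z⟩
  let u : Fin (n + 2) → Bool → Subgroup.zpowers z :=
    Fin.append (fun _ _ => 1) ![fun b => bif b then z' else 1, fun b => bif b then 1 else z']
  let p : unitInterval := ⟨1 / 2, by norm_num, by norm_num⟩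
  have h₀ : 0 < p := Subtype.coe_lt_coe.1 (by norm_num [p])
  have h₁ : p < 1 := Subtype.coe_lt_coe.1 (by norm_num [p])
  refine ⟨twistedMeasure u (Fin.append a ![t, t]) p,
    isNonatomicInvariantLift_twistedMeasure ha (e := Fin.castAdd 2) (fun j b => by simp [u])
      (i := Fin.natAdd n 0) ?_ h₀ h₁ _ fun ω => ?_⟩
  · rintro (_ | _) (_ | _) h
    · rfl
    · exact absurd (congrArg Subtype.val h) (by simpa [u, z'] using hz.symm)
    · exact absurd (congrArg Subtype.val h) (by simpa [u, z'] using hz)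
    · rfl
  · refine underlyingRooted_iso (Equiv.refl G) (Equiv.prodCongrRight fun x : G =>
      bif ω x then Equiv.swap (Fin.natAdd n 0) (Fin.natAdd n 1) else Equiv.refl _) rfl fun x i => ?_
    simp only [Equiv.prodCongrRight_apply, Equiv.refl_apply, twistedStep_apply]
    refine Fin.addCases (fun j => ?_) (fun j => ?_) i
    · have hj : ∀ k : Fin 2, Fin.castAdd 2 j ≠ Fin.natAdd n k := fun k h => by
        have := congrArg Fin.val h
        simp at this
        omega
      cases ω x <;> simp [u, Equiv.swap_apply_of_ne_of_ne (hj 0) (hj 1)]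
    · cases ω x <;> fin_cases j <;> simp [u, z', mul_assoc]

theorem mainTheorem2 {G : Type u} [Group G] [Infinite G] (hG : ¬ IsCyclic G)
    {n : ℕ} (a : Fin n → G) (ha : Subgroup.closure (Set.range a) = ⊤)
    (h2 : ∀ i j : Fin n, i ≠ j → orderOf (a i * a j) ≠ 2) :
    (∃ (k : ℕ) (b : Fin k → G) (μ : Measure (SchreierSpace (n + k))),
      IsNonatomicInvariantLift μ (cayleyGraph (Fin.append a b) (closure_append ha b))) ∧
    (∀ i j : Fin n, i ≠ j → a i * a j ≠ 1 →
      Infinite (G ⧸ Subgroup.zpowers (a i * a j)) →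
      ∀ p : unitInterval, 0 < p → p < 1 →
        IsNonatomicInvariantLift (reversalMeasure a (a i * a j) p)
          (cayleyGraph (Fin.append a ![a i * a j]) (closure_append ha ![a i * a j]))) ∧
    ((∀ g : G, Infinite (G ⧸ Subgroup.zpowers g)) →
      ∃ i j : Fin n, i ≠ j ∧ a i * a j ≠ 1 ∧
        Infinite (G ⧸ Subgroup.zpowers (a i * a j))) := by
  refine ⟨?_, fun i j hij hne _ p h₀ h₁ => ?_, fun hinf => ?_⟩
  · obtain ⟨z, hz, _⟩ := exists_infinite_quotient_zpowers hG ha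
    -- Any `t` would do; this choice makes both adjoined elements `t` and `z * t` nontrivial.
    obtain ⟨t, _⟩ : ∃ t : G, t ∉ ({1, z⁻¹} : Set G) :=
      (Set.toFinite ({1, z⁻¹} : Set G)).exists_notMem
    exact ⟨2, ![t, z * t], exists_isNonatomicInvariantLift_append ha hz t⟩
  · exact isNonatomicInvariantLift_reversalMeasure ha
      (fun h => h2 i j hij (orderOf_eq_prime h hne)) h₀ h₁
  · by_contra! h
    refine hG (isCyclic_of_mul_eq_one ha fun i j hij => ?_)
    by_contra hne
    have := h i j hij hne
    have := hinf (a i * a j)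
    exact not_finite (G ⧸ Subgroup.zpowers (a i * a j))
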